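/- For a complex $n\times n$ matrix $A$ let $\|A\|_\infty$ be its operator norm on $\mathbb C^n$ with the Euclidean norm. The Schur multiplier norm of $Y\in M_n(\mathbb C)$ is $$\|Y\|_S=\sup\{\|Y\circ A\|_\infty : A\in M_n(\mathbb C),\ \|A\|_\infty\le 1\},$$ where $Y\circ A$ is the entrywise product, and $\|X\|_{cbB}=\sup\{|\mathrm{Tr}_n(Y^*X)| : Y\in M_n(\mathbb C),\ \|Y\|_S\le 1\}$ is its dual norm. For $\lambda\in\mathbb R^n$ let $\Delta(\lambda)$ be the diagonal matrix with diagonal $\lambda$; a diagonal matrix $\Delta(\lambda)$ is called positive if all $\lambda_i\ge 0$. The order on self-adjoint matrices is the usual (positive semidefinite) one, and the support of a matrix is the orthogonal complement of its kernel. Let $X$ be a complex self-adjoint $n\times n$ matrix. 1. If $\Delta(\lambda)$ is a positive diagonal matrix with $-\Delta(\lambda)\le X\le\Delta(\lambda)$, then $\|X\|_{cbB}\le \mathrm{Tr}_n(\Delta(\lambda))$. 2. There exists a unique positive diagonal matrix $\Delta(\lambda)$ such that $\mathrm{Tr}_n(\Delta(\lambda))=\|X\|_{cbB}$ and $X=\sqrt{\Delta(\lambda)}\,B\,\sqrt{\Delta(\lambda)}$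 for some self-adjoint matrix $B$ with $\|B\|_\infty\le 1$. 3. For this $\Delta(\lambda)$ there is exactly one self-adjoint matrix $B$ with $\|B\|_\infty\le 1$ and $X=\sqrt{\Delta(\lambda)}\,B\,\sqrt{\Delta(\lambda)}$ whose support is contained in the support of $\Delta(\lambda)$. -/

import Mathlib

open scoped Matrix MatrixOrder Matrix.Norms.L2Operator

noncomputable section

namespace SchurDual

/-- The entrywise (Schur) multiplication `A ↦ Y ∘ A` on complex `m × n` matrices. -/
def schurMul {m n : ℕ} (Y : Matrix (Fin m) (Fin n) ℂ) :
    Matrix (Fin m) (Fin n) ℂ →ₗ[ℂ] Matrix (Fin m) (Fin n) ℂ where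
  toFun A := Y ⊙ A
  map_add' A B := Matrix.hadamard_add Y A B
  map_smul' c A := Matrix.hadamard_smul Y A c

/-- The Schur multiplier norm: the norm of `A ↦ Y ∘ A` as an operator on the space of matrices
equipped with the operator norm (the norm `‖A‖` of a matrix is everywhere the one of the operator
between Euclidean spaces). -/
def schurNorm {m n : ℕ} (Y : Matrix (Fin m) (Fin n) ℂ) : ℝ :=
  ‖LinearMap.toContinuousLinearMap (schurMul Y)‖

/-- The dual norm of the Schur multiplier norm for the pairing `⟨X, Y⟩ = Tr (Y* X)`. -/
def cbBNorm {m n : ℕ} (X : Matrix (Fin m) (Fin n) ℂ) : ℝ :=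
  sSup {r : ℝ | ∃ Y : Matrix (Fin m) (Fin n) ℂ, schurNorm Y ≤ 1 ∧ r = ‖(Yᴴ * X).trace‖}

/-- The complex diagonal matrix with real diagonal `lam`. -/
def Delta {n : ℕ} (lam : Fin n → ℝ) : Matrix (Fin n) (Fin n) ℂ :=
  Matrix.diagonal fun i => (lam i : ℂ)

/-- The positive square root of `Delta lam`, for `lam` with nonnegative entries. -/
def sqrtDelta {n : ℕ} (lam : Fin n → ℝ) : Matrix (Fin n) (Fin n) ℂ :=
  Delta fun i => Real.sqrt (lam i)

/-- The support of a matrix, as a subspace: the orthogonal complement of its kernel. -/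
def support {m n : ℕ} (A : Matrix (Fin m) (Fin n) ℂ) : Submodule ℂ (EuclideanSpace ℂ (Fin n)) :=
  (LinearMap.ker (Matrix.toEuclideanLin A))ᗮ

/-- `X = √Δ(lam) B √Δ(lam)` with `B` a self-adjoint contraction. -/
def IsFactor {n : ℕ} (X : Matrix (Fin n) (Fin n) ℂ) (lam : Fin n → ℝ)
    (B : Matrix (Fin n) (Fin n) ℂ) : Prop :=
  B.IsHermitian ∧ ‖B‖ ≤ 1 ∧ X = sqrtDelta lam * B * sqrtDelta lam

end SchurDual

end

/-!
The norm dual to the Schur multiplier norm is computed by maximising `Re Tr ((P - Q) X)` over the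
pairs of positive matrices with `P + Q` of unit diagonal. By the Schur product theorem, applied to
the block matrices with blocks `P + Q`, `P - Q` and `1`, `A`, such a `P - Q` is a contractive Schur
multiplier. If `(P, Q)` is a maximiser, then comparing it with `(C P C + t S, C Q C)`, where `S` is
positive and `C ^ 2 = 1 - t diag S` restores the constraint, gives at first order in `t`
`Re Tr (S X) ≤ ∑ i, S i i * lam i` with `lam i = Re ((P - Q) X) i i`, that is `X ≤ Δ` for
`Δ = Delta lam`; exchanging `P` and `Q` gives `-Δ ≤ X`. Conversely `-Δ ≤ X ≤ Δ` means that
`X = √Δ B √Δ` with a contraction `B`, so that `cbBNorm X ≤ ∑ i, lam i`. When equality holds,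
`P (Δ - X) = 0 = Q (Δ + X)` by complementary slackness, and the diagonal of
`(P + Q) Δ = (P - Q) X` determines `lam`.
-/

namespace SchurDual

open scoped ComplexOrder
open Matrix

section CStar

variable {A : Type*} [CStarAlgebra A] [PartialOrder A] [StarOrderedRing A]

theorem norm_le_one_iff_of_isSelfAdjoint {a : A} (ha : IsSelfAdjoint a) :
    ‖a‖ ≤ 1 ↔ -1 ≤ a ∧ a ≤ 1 := by
  constructor
  · intro h
    have hle : algebraMap ℝ A ‖a‖ ≤ 1 := by
      simpa using algebraMap_mono A h
    exact ⟨(neg_le_neg hle).trans ha.neg_algebraMap_norm_le_self,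
      ha.le_algebraMap_norm_self.trans hle⟩
  · rintro ⟨hneg, hpos⟩
    nontriviality A
    have hspec : ∀ x ∈ spectrum ℝ a, x ∈ Set.Icc (-1) 1 := fun x hx =>
      ⟨(algebraMap_le_iff_le_spectrum (r := -1)).1 (by simpa using hneg) x hx,
        (le_algebraMap_iff_spectrum_le (r := 1)).1 (by simpa using hpos) x hx⟩
    rcases CStarAlgebra.norm_or_neg_norm_mem_spectrum ha with h | h
    · exact (hspec _ h).2
    · exact neg_le_neg_iff.1 (hspec _ h).1

end CStar

section Contraction

variable {ι κ : Type*} [Fintype ι] [Fintype κ] [DecidableEq κ]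

theorem posSemidef_fromBlocks_one_iff [DecidableEq ι] (A : Matrix ι κ ℂ) :
    (fromBlocks 1 A Aᴴ 1).PosSemidef ↔ ‖A‖ ≤ 1 := by
  let := invertibleOne (α := Matrix ι ι ℂ)
  rw [PosDef.one.fromBlocks₁₁, inv_one, Matrix.mul_one, ← le_iff,
    ← CStarAlgebra.norm_le_one_iff_of_nonneg _ (posSemidef_conjTranspose_mul_self A).nonneg,
    l2_opNorm_conjTranspose_mul_self, ← sq, sq_le_one_iff₀ (norm_nonneg A)]

theorem norm_map_star_le_one {A : Matrix ι κ ℂ} (hA : ‖A‖ ≤ 1) : ‖A.map star‖ ≤ 1 := by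
  classical
  -- Positivity of the block matrix is preserved by transposition, which conjugates `A`.
  rw [← posSemidef_fromBlocks_one_iff] at hA ⊢
  simpa [fromBlocks_transpose, conjTranspose, transpose_map, Function.comp_def] using hA.transpose

theorem norm_dotProduct_mulVec_le (A : Matrix ι κ ℂ) (a : EuclideanSpace ℂ ι)
    (b : EuclideanSpace ℂ κ) : ‖star a.ofLp ⬝ᵥ A *ᵥ b.ofLp‖ ≤ ‖A‖ * (‖a‖ * ‖b‖) := by
  calc ‖star a.ofLp ⬝ᵥ A *ᵥ b.ofLp‖ = ‖inner ℂ a (WithLp.toLp 2 (A *ᵥ b.ofLp))‖ := by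
        rw [EuclideanSpace.inner_eq_star_dotProduct, dotProduct_comm]
    _ ≤ ‖a‖ * ‖WithLp.toLp 2 (A *ᵥ b.ofLp)‖ := norm_inner_le_norm _ _
    _ ≤ ‖a‖ * (‖A‖ * ‖b‖) := by gcongr; exact l2_opNorm_mulVec A b
    _ = ‖A‖ * (‖a‖ * ‖b‖) := mul_left_comm _ _ _

end Contraction

section PosSemidef

variable {ι : Type*} [Fintype ι]

theorem trace_mul_nonneg {A B : Matrix ι ι ℂ} (hA : A.PosSemidef) (hB : B.PosSemidef) :
    0 ≤ (A * B).trace := by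
  classical
  obtain ⟨W, rfl⟩ := CStarAlgebra.nonneg_iff_eq_star_mul_self.1 hA.nonneg
  rw [← trace_mul_cycle]
  exact (hB.mul_mul_conjTranspose_same W).trace_nonneg

theorem mul_eq_zero_of_trace_mul_eq_zero {A B : Matrix ι ι ℂ} (hA : A.PosSemidef)
    (hB : B.PosSemidef) (h : (A * B).trace = 0) : A * B = 0 := by
  classical
  obtain ⟨W, rfl⟩ := CStarAlgebra.nonneg_iff_eq_star_mul_self.1 hA.nonneg
  obtain ⟨V, rfl⟩ := CStarAlgebra.nonneg_iff_eq_star_mul_self.1 hB.nonneg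
  simp only [star_eq_conjTranspose] at h ⊢
  have hVW : V * Wᴴ = 0 := by
    rw [← trace_conjTranspose_mul_self_eq_zero_iff, ← h, Matrix.mul_assoc Wᴴ, trace_mul_comm Wᴴ]
    simp only [conjTranspose_mul, conjTranspose_conjTranspose, Matrix.mul_assoc]
  calc Wᴴ * W * (Vᴴ * V) = Wᴴ * (V * Wᴴ)ᴴ * V := by
        simp only [conjTranspose_mul, conjTranspose_conjTranspose, Matrix.mul_assoc]
    _ = 0 := by simp only [hVW, conjTranspose_zero, Matrix.mul_zero, Matrix.zero_mul]

theorem posSemidef_of_forall_trace_mul_nonneg {A : Matrix ι ι ℂ} (hA : A.IsHermitian)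
    (h : ∀ S : Matrix ι ι ℂ, S.PosSemidef → 0 ≤ (S * A).trace.re) : A.PosSemidef := by
  refine .of_dotProduct_mulVec_nonneg hA fun v => ?_
  have htr : (vecMulVec v (star v) * A).trace = star v ⬝ᵥ A *ᵥ v := by
    rw [trace_mul_comm, mul_vecMulVec, trace_vecMulVec, dotProduct_comm]
  refine Complex.nonneg_iff.2 ⟨?_, (hA.im_star_dotProduct_mulVec_self v).symm⟩
  exact htr ▸ h _ (posSemidef_vecMulVec_self_star v)

theorem mulVec_eq_zero_of_neg_le_of_le {H X : Matrix ι ι ℂ} (hneg : -H ≤ X) (hpos : X ≤ H)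
    {v : ι → ℂ} (hv : H *ᵥ v = 0) : X *ᵥ v = 0 := by
  have hsub : (H - X) *ᵥ v = -(X *ᵥ v) := by rw [sub_mulVec, hv, zero_sub]
  have hadd : (X - -H) *ᵥ v = X *ᵥ v := by rw [sub_neg_eq_add, add_mulVec, hv, add_zero]
  have hle := (le_iff.1 hpos).dotProduct_mulVec_nonneg v
  have hge := (le_iff.1 hneg).dotProduct_mulVec_nonneg v
  rw [hsub, dotProduct_neg] at hle
  rw [hadd] at hge
  have hzero : star v ⬝ᵥ X *ᵥ v = 0 := le_antisymm (neg_nonneg.1 hle) hge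
  rw [← neg_eq_zero, ← hsub, ← (le_iff.1 hpos).dotProduct_mulVec_zero_iff, hsub, dotProduct_neg,
    hzero, neg_zero]

variable [DecidableEq ι]

theorem le_algebraMap_norm_of_diag_eq_one {R : Matrix ι ι ℂ} (hR : R.PosSemidef)
    (hdiag : R.diag = 1) : R ≤ algebraMap ℝ _ ‖(of 1 : Matrix ι ι ℂ)‖ := by
  -- The Schur product of `R` with `‖J‖ - J`, for `J` the all-ones matrix, is `‖J‖ - R`.
  have hone : (of 1 : Matrix ι ι ℂ).IsHermitian := by ext; simp
  have h := hR.hadamard (le_iff.1 hone.isSelfAdjoint.le_algebraMap_norm_self)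
  rw [le_iff]
  convert h using 1
  ext i j
  have hRi : R i i = 1 := congrFun hdiag i
  by_cases hij : i = j
  · subst hij
    simp [hRi, Algebra.algebraMap_eq_smul_one]
  · simp [Algebra.algebraMap_eq_smul_one, hij]

end PosSemidef

section SchurNorm

variable {m n : ℕ}

theorem norm_hadamard_le (Y A : Matrix (Fin m) (Fin n) ℂ) : ‖Y ⊙ A‖ ≤ schurNorm Y * ‖A‖ :=
  (LinearMap.toContinuousLinearMap (schurMul Y)).le_opNorm A

theorem schurNorm_le_one_of_posSemidef_fromBlocks {Y : Matrix (Fin m) (Fin n) ℂ}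
    {P : Matrix (Fin m) (Fin m) ℂ} {Q : Matrix (Fin n) (Fin n) ℂ}
    (h : (fromBlocks P Y Yᴴ Q).PosSemidef) (hP : P.diag = 1) (hQ : Q.diag = 1) :
    schurNorm Y ≤ 1 := by
  refine ContinuousLinearMap.opNorm_le_of_unit_norm (𝕜 := ℂ) zero_le_one fun A hA => ?_
  have hblocks := h.hadamard ((posSemidef_fromBlocks_one_iff A).2 hA.le)
  have hprod : fromBlocks P Y Yᴴ Q ⊙ fromBlocks 1 A Aᴴ 1 =
      fromBlocks (P ⊙ 1) (Y ⊙ A) (Y ⊙ A)ᴴ (Q ⊙ 1) := by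
    ext (i | i) (j | j) <;> simp
  rw [hprod, hadamard_one_eq_one_iff.2 hP, hadamard_one_eq_one_iff.2 hQ] at hblocks
  exact (posSemidef_fromBlocks_one_iff (Y ⊙ A)).1 hblocks

theorem posSemidef_fromBlocks_add_sub {ι : Type*} [Finite ι] {P Q : Matrix ι ι ℂ}
    (hP : P.PosSemidef) (hQ : Q.PosSemidef) :
    (fromBlocks (P + Q) (P - Q) (P - Q)ᴴ (P + Q)).PosSemidef := by
  classical
  cases nonempty_fintype ι
  have hsum := (hP.conjTranspose_mul_mul_same (fromCols (1 : Matrix ι ι ℂ) (1 : Matrix ι ι ℂ))).add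
    (hQ.conjTranspose_mul_mul_same (fromCols (1 : Matrix ι ι ℂ) (-1 : Matrix ι ι ℂ)))
  convert hsum using 1
  simp [conjTranspose_fromCols_eq_fromRows_conjTranspose, fromRows_mul, mul_fromCols,
    fromBlocks_add, hP.isHermitian.eq, hQ.isHermitian.eq, sub_eq_add_neg]

theorem schurNorm_sub_le_one {P Q : Matrix (Fin n) (Fin n) ℂ} (hP : P.PosSemidef)
    (hQ : Q.PosSemidef) (hdiag : (P + Q).diag = 1) : schurNorm (P - Q) ≤ 1 :=
  schurNorm_le_one_of_posSemidef_fromBlocks (posSemidef_fromBlocks_add_sub hP hQ) hdiag hdiag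

theorem norm_map_star_hadamard_le_one {Y B : Matrix (Fin m) (Fin n) ℂ} (hY : schurNorm Y ≤ 1)
    (hB : ‖B‖ ≤ 1) : ‖Y.map star ⊙ B‖ ≤ 1 := by
  have hstar : ‖Y ⊙ B.map star‖ ≤ 1 :=
    (norm_hadamard_le _ _).trans (mul_le_one₀ hY (norm_nonneg _) (norm_map_star_le_one hB))
  convert norm_map_star_le_one hstar using 2
  ext
  simp

theorem norm_trace_conjTranspose_mul_le {Y B : Matrix (Fin m) (Fin n) ℂ} (hY : schurNorm Y ≤ 1)
    (hB : ‖B‖ ≤ 1) (a : EuclideanSpace ℂ (Fin m)) (b : EuclideanSpace ℂ (Fin n)) :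
    ‖(Yᴴ * (diagonal (star a.ofLp) * B * diagonal b.ofLp)).trace‖ ≤ ‖a‖ * ‖b‖ := by
  have htrace : (Yᴴ * (diagonal (star a.ofLp) * B * diagonal b.ofLp)).trace =
      star a.ofLp ⬝ᵥ (Y.map star ⊙ B) *ᵥ b.ofLp := by
    rw [dotProduct_mulVec, hadamard_comm, dotProduct_vecMul_hadamard, transpose_mul,
      diagonal_transpose, trace_mul_comm Yᴴ, Matrix.mul_assoc (_ * B)]
    rfl
  rw [htrace]
  refine (norm_dotProduct_mulVec_le _ a b).trans (mul_le_of_le_one_left (by positivity) ?_)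
  exact norm_map_star_hadamard_le_one hY hB

end SchurNorm

section Delta

variable {n : ℕ} {X M B : Matrix (Fin n) (Fin n) ℂ} {lam : Fin n → ℝ}

theorem trace_Delta (lam : Fin n → ℝ) : (Delta lam).trace = ((∑ i, lam i : ℝ) : ℂ) := by
  simp [Delta, trace_diagonal]

theorem isHermitian_Delta (lam : Fin n → ℝ) : (Delta lam).IsHermitian :=
  isHermitian_diagonal_of_self_adjoint _ (by ext; simp)

theorem Delta_mul_Delta (lam mu : Fin n → ℝ) : Delta lam * Delta mu = Delta (lam * mu) := by
  simp [Delta, diagonal_mul_diagonal]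

theorem Delta_mulVec_eq_zero_iff {v : Fin n → ℂ} :
    Delta lam *ᵥ v = 0 ↔ ∀ i, lam i = 0 ∨ v i = 0 := by
  simp [Delta, funext_iff, mulVec_diagonal]

theorem Delta_le_one (h : ∀ i, lam i ≤ 1) : Delta lam ≤ 1 := by
  rw [le_iff, ← diagonal_one, Delta, diagonal_sub, posSemidef_diagonal_iff]
  exact_mod_cast fun i => sub_nonneg.2 (h i)

theorem nonneg_of_neg_Delta_le_of_le_Delta (hneg : -Delta lam ≤ X) (hpos : X ≤ Delta lam)
    (i : Fin n) : 0 ≤ lam i := by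
  have h := (le_iff.1 (hneg.trans hpos)).diag_nonneg (i := i)
  simp only [Delta, sub_neg_eq_add, Matrix.add_apply, diagonal_apply_eq] at h
  norm_cast at h
  linarith

theorem sqrtDelta_mul_sqrtDelta (hlam : ∀ i, 0 ≤ lam i) :
    sqrtDelta lam * sqrtDelta lam = Delta lam := by
  simp only [sqrtDelta, Delta_mul_Delta]
  exact congrArg Delta (funext fun i => Real.mul_self_sqrt (hlam i))

theorem support_le_support_iff {A : Matrix (Fin n) (Fin n) ℂ} :
    support A ≤ support B ↔ ∀ v, B *ᵥ v = 0 → A *ᵥ v = 0 := by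
  rw [support, support, Submodule.orthogonal_le_orthogonal_iff]
  constructor
  · intro h v hv
    simpa using h (x := WithLp.toLp 2 v) (by simpa using hv)
  · intro h v hv
    exact congrArg (WithLp.toLp 2) (h v.ofLp (congrArg WithLp.ofLp hv))

/-- The Moore–Penrose inverse of `sqrtDelta lam`: since `0⁻¹ = 0`, it vanishes off the support
of `Delta lam`. -/
noncomputable def pinvSqrtDelta (lam : Fin n → ℝ) : Matrix (Fin n) (Fin n) ℂ :=
  Delta fun i => (√(lam i))⁻¹

theorem commute_sqrtDelta_pinvSqrtDelta (lam : Fin n → ℝ) :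
    Commute (sqrtDelta lam) (pinvSqrtDelta lam) := by
  simp only [Commute, SemiconjBy, sqrtDelta, pinvSqrtDelta, Delta_mul_Delta, mul_comm]

theorem mul_sqrtDelta_mul_pinvSqrtDelta (hlam : ∀ i, 0 ≤ lam i)
    (hM : support M ≤ support (Delta lam)) : M * (sqrtDelta lam * pinvSqrtDelta lam) = M := by
  refine ext_iff_mulVec.2 fun v => ?_
  rw [← sub_eq_zero, ← mulVec_mulVec, ← mulVec_sub]
  refine support_le_support_iff.1 hM _ (Delta_mulVec_eq_zero_iff.2 fun i => ?_)
  rw [or_iff_not_imp_left]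
  intro hi
  have hsqrt : (√(lam i) : ℂ) ≠ 0 := by
    exact_mod_cast Real.sqrt_ne_zero'.2 ((hlam i).lt_of_ne' hi)
  simp [sqrtDelta, pinvSqrtDelta, Delta, mulVec_diagonal, hsqrt]

theorem sqrtDelta_pinvSqrtDelta_conj (hlam : ∀ i, 0 ≤ lam i) (hM : M.IsHermitian)
    (hsupp : support M ≤ support (Delta lam)) :
    sqrtDelta lam * pinvSqrtDelta lam * M * (sqrtDelta lam * pinvSqrtDelta lam) = M := by
  have hright := mul_sqrtDelta_mul_pinvSqrtDelta hlam hsupp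
  have hleft := congrArg conjTranspose hright
  rw [conjTranspose_mul, conjTranspose_mul, hM.eq, sqrtDelta, pinvSqrtDelta,
    isHermitian_Delta, isHermitian_Delta] at hleft
  rw [Matrix.mul_assoc, hright, (commute_sqrtDelta_pinvSqrtDelta lam).eq]
  exact hleft

theorem support_pinvSqrtDelta_conj_le :
    support (pinvSqrtDelta lam * M * pinvSqrtDelta lam) ≤ support (Delta lam) := by
  refine support_le_support_iff.2 fun v hv => ?_
  have : pinvSqrtDelta lam *ᵥ v = 0 :=
    Delta_mulVec_eq_zero_iff.2 fun i =>
      (Delta_mulVec_eq_zero_iff.1 hv i).imp_left fun hi => by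
        rw [hi, Real.sqrt_zero, _root_.inv_zero]
  rw [← mulVec_mulVec, this, mulVec_zero]

theorem pinvSqrtDelta_mul_Delta_mul_pinvSqrtDelta_le_one :
    pinvSqrtDelta lam * Delta lam * pinvSqrtDelta lam ≤ 1 := by
  rw [pinvSqrtDelta, Delta_mul_Delta, Delta_mul_Delta]
  refine Delta_le_one fun i => ?_
  simp only [Pi.mul_apply]
  rcases le_or_gt (lam i) 0 with h | h
  · simp [Real.sqrt_eq_zero_of_nonpos h]
  · field_simp
    exact (Real.sq_sqrt h.le).ge

theorem norm_pinvSqrtDelta_conj_le_one (hX : X.IsHermitian) (hneg : -Delta lam ≤ X)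
    (hpos : X ≤ Delta lam) : ‖pinvSqrtDelta lam * X * pinvSqrtDelta lam‖ ≤ 1 := by
  have hR : IsSelfAdjoint (pinvSqrtDelta lam) := isHermitian_Delta _
  have hone := pinvSqrtDelta_mul_Delta_mul_pinvSqrtDelta_le_one (lam := lam)
  refine (norm_le_one_iff_of_isSelfAdjoint (hX.isSelfAdjoint.conjugate_self hR)).2 ⟨?_, ?_⟩
  · refine (neg_le_neg hone).trans ?_
    simpa using hR.conjugate_le_conjugate hneg
  · exact (hR.conjugate_le_conjugate hpos).trans hone

theorem IsFactor.neg_Delta_le_and_le_Delta (hlam : ∀ i, 0 ≤ lam i) (h : IsFactor X lam B) :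
    -Delta lam ≤ X ∧ X ≤ Delta lam := by
  obtain ⟨hB, hnorm, rfl⟩ := h
  have hS : IsSelfAdjoint (sqrtDelta lam) := isHermitian_Delta _
  obtain ⟨hneg, hpos⟩ := (norm_le_one_iff_of_isSelfAdjoint hB.isSelfAdjoint).1 hnorm
  rw [← sqrtDelta_mul_sqrtDelta hlam]
  constructor
  · simpa using hS.conjugate_le_conjugate hneg
  · simpa using hS.conjugate_le_conjugate hpos

theorem isFactor_pinvSqrtDelta_conj (hX : X.IsHermitian) (hneg : -Delta lam ≤ X)
    (hpos : X ≤ Delta lam) :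
    IsFactor X lam (pinvSqrtDelta lam * X * pinvSqrtDelta lam) := by
  have hlam := nonneg_of_neg_Delta_le_of_le_Delta hneg hpos
  have hsupp : support X ≤ support (Delta lam) :=
    support_le_support_iff.2 fun _ => mulVec_eq_zero_of_neg_le_of_le hneg hpos
  refine ⟨hX.isSelfAdjoint.conjugate_self (isHermitian_Delta _),
    norm_pinvSqrtDelta_conj_le_one hX hneg hpos, ?_⟩
  conv_lhs => rw [← sqrtDelta_pinvSqrtDelta_conj hlam hX hsupp]
  nth_rw 2 [(commute_sqrtDelta_pinvSqrtDelta lam).eq]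
  simp only [Matrix.mul_assoc]

theorem IsFactor.eq_pinvSqrtDelta_conj (hlam : ∀ i, 0 ≤ lam i) (h : IsFactor X lam B)
    (hsupp : support B ≤ support (Delta lam)) :
    B = pinvSqrtDelta lam * X * pinvSqrtDelta lam := by
  obtain ⟨hB, -, rfl⟩ := h
  conv_lhs => rw [← sqrtDelta_pinvSqrtDelta_conj hlam hB hsupp]
  nth_rw 1 [(commute_sqrtDelta_pinvSqrtDelta lam).eq]
  simp only [Matrix.mul_assoc]

theorem existsUnique_isFactor_support_le (hX : X.IsHermitian) (hneg : -Delta lam ≤ X)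
    (hpos : X ≤ Delta lam) :
    ∃! B, IsFactor X lam B ∧ support B ≤ support (Delta lam) :=
  ⟨_, ⟨isFactor_pinvSqrtDelta_conj hX hneg hpos, support_pinvSqrtDelta_conj_le⟩,
    fun _ h => h.1.eq_pinvSqrtDelta_conj (nonneg_of_neg_Delta_le_of_le_Delta hneg hpos) h.2⟩

theorem IsFactor.norm_trace_conjTranspose_mul_le (hlam : ∀ i, 0 ≤ lam i) (h : IsFactor X lam B)
    {Y : Matrix (Fin n) (Fin n) ℂ} (hY : schurNorm Y ≤ 1) :
    ‖(Yᴴ * X).trace‖ ≤ ∑ i, lam i := by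
  obtain ⟨-, hB, rfl⟩ := h
  set a : EuclideanSpace ℂ (Fin n) := WithLp.toLp 2 fun i => (√(lam i) : ℂ)
  have hstar : star a.ofLp = a.ofLp := by ext; simp [a]
  have hnorm : ‖a‖ * ‖a‖ = ∑ i, lam i := by
    rw [← sq, EuclideanSpace.norm_sq_eq]
    exact Finset.sum_congr rfl fun i _ => by simp [a, Real.sq_sqrt (hlam i)]
  have := SchurDual.norm_trace_conjTranspose_mul_le hY hB a a
  rwa [hstar, hnorm] at this

theorem IsFactor.cbBNorm_le (hlam : ∀ i, 0 ≤ lam i) (h : IsFactor X lam B) :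
    cbBNorm X ≤ ∑ i, lam i := by
  refine Real.sSup_le ?_ (Finset.sum_nonneg fun i _ => hlam i)
  rintro _ ⟨Y, hY, rfl⟩
  exact h.norm_trace_conjTranspose_mul_le hlam hY

theorem IsFactor.cbBNorm_eq (hlam : ∀ i, 0 ≤ lam i) (h : IsFactor X lam B)
    {Y : Matrix (Fin n) (Fin n) ℂ} (hY : schurNorm Y ≤ 1)
    (hsum : ∑ i, lam i ≤ ‖(Yᴴ * X).trace‖) : cbBNorm X = ∑ i, lam i := by
  refine le_antisymm (h.cbBNorm_le hlam) (hsum.trans (le_csSup ⟨∑ i, lam i, ?_⟩ ⟨Y, hY, rfl⟩))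
  rintro _ ⟨Z, hZ, rfl⟩
  exact h.norm_trace_conjTranspose_mul_le hlam hZ

end Delta

theorem re_mul_apply_comm {ι : Type*} {W X : Matrix ι ι ℂ} (hW : W.IsHermitian)
    (hX : X.IsHermitian) (i j : ι) :
    (W j i * X i j).re = (W i j * X j i).re := by
  rw [← hW.apply j i, ← hX.apply i j, ← star_mul', ← starRingEnd_apply, Complex.conj_re]

theorem hasDerivAt_nonpos_of_isLocalMaxOn_Ici {f : ℝ → ℝ} {f' a : ℝ}
    (hmax : IsLocalMaxOn f (Set.Ici a) a) (hf : HasDerivAt f f' a) : f' ≤ 0 := by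
  have hcone : (1 : ℝ) ∈ posTangentConeAt (Set.Ici a) a := by
    refine mem_posTangentConeAt_of_segment_subset ?_
    rw [segment_eq_Icc (by linarith)]
    exact Set.Icc_subset_Ici_self
  simpa using hmax.hasFDerivWithinAt_nonpos hf.hasFDerivAt.hasFDerivWithinAt hcone

theorem hasDerivAt_sum_sqrt_mul_sqrt {ι : Type*} [Fintype ι] {y : ι → ι → ℝ}
    (hy : ∀ i j, y j i = y i j) (s : ι → ℝ) :
    HasDerivAt (fun t : ℝ => ∑ i, ∑ j, √(1 - t * s i) * √(1 - t * s j) * y i j)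
      (-∑ i, s i * ∑ j, y i j) 0 := by
  have hsqrt (i : ι) : HasDerivAt (fun t : ℝ => √(1 - t * s i)) (-s i / 2) 0 := by
    simpa using (((hasDerivAt_id (0 : ℝ)).mul_const (s i)).const_sub 1).sqrt (by simp)
  have hcomm : ∑ i, ∑ j, s j * y i j = ∑ i, ∑ j, s i * y i j := by
    rw [Finset.sum_comm]
    simp only [hy]
  refine (HasDerivAt.fun_sum fun i _ => HasDerivAt.fun_sum fun j _ =>
    ((hsqrt i).fun_mul (hsqrt j)).mul_const (y i j)).congr_deriv ?_
  calc ∑ i, ∑ j, (-s i / 2 * √(1 - 0 * s j) + √(1 - 0 * s i) * (-s j / 2)) * y i j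
      = -(∑ i, ∑ j, s i * y i j + ∑ i, ∑ j, s j * y i j) / 2 := by
        simp only [← Finset.sum_add_distrib, ← Finset.sum_neg_distrib, Finset.sum_div]
        refine Finset.sum_congr rfl fun i _ => Finset.sum_congr rfl fun j _ => ?_
        simp only [zero_mul, sub_zero, Real.sqrt_one]
        ring
    _ = -∑ i, s i * ∑ j, y i j := by
        rw [hcomm]
        simp only [Finset.mul_sum]
        ring

section Pairing

variable {ι : Type*} {p : Matrix ι ι ℂ × Matrix ι ι ℂ}

variable (ι) in
/-- The pairs `(P, Q)` of positive matrices with `P + Q` of unit diagonal. Their differences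
`P - Q` are the self-adjoint Schur multipliers over which the norm dual to `schurNorm` is
computed. -/
def feasiblePairs : Set (Matrix ι ι ℂ × Matrix ι ι ℂ) :=
  {p | 0 ≤ p.1 ∧ 0 ≤ p.2 ∧ (p.1 + p.2).diag = 1}

theorem swap_mem_feasiblePairs (hp : p ∈ feasiblePairs ι) : p.swap ∈ feasiblePairs ι :=
  ⟨hp.2.1, hp.1, by rw [Prod.fst_swap, Prod.snd_swap, add_comm]; exact hp.2.2⟩

theorem isCompact_feasiblePairs [Finite ι] : IsCompact (feasiblePairs ι) := by
  classical
  cases nonempty_fintype ι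
  have : ProperSpace (Matrix ι ι ℂ) := FiniteDimensional.proper ℂ _
  refine Metric.isCompact_of_isClosed_isBounded ?_ ?_
  · refine (isClosed_le continuous_const continuous_fst).inter
      ((isClosed_le continuous_const continuous_snd).inter
        (isClosed_eq ?_ continuous_const))
    exact (continuous_fst.add continuous_snd).matrix_diag
  · refine isBounded_iff_forall_norm_le.2 ⟨‖(of 1 : Matrix ι ι ℂ)‖, fun p ⟨hP, hQ, hdiag⟩ => ?_⟩
    have hsum : p.1 + p.2 ≤ algebraMap ℝ _ ‖(of 1 : Matrix ι ι ℂ)‖ :=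
      le_algebraMap_norm_of_diag_eq_one (add_nonneg hP hQ).posSemidef hdiag
    refine norm_prod_le_iff.2 ⟨?_, ?_⟩
    · exact (CStarAlgebra.norm_le_iff_le_algebraMap _ (norm_nonneg _) hP).2
        ((le_add_of_nonneg_right hQ).trans hsum)
    · exact (CStarAlgebra.norm_le_iff_le_algebraMap _ (norm_nonneg _) hQ).2
        ((le_add_of_nonneg_left hP).trans hsum)

variable [Fintype ι]

/-- The real pairing of `X` with the multiplier `P - Q`. -/
def pairing (X : Matrix ι ι ℂ) (p : Matrix ι ι ℂ × Matrix ι ι ℂ) : ℝ :=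
  ((p.1 - p.2) * X).trace.re

/-- The Lagrange multipliers of the constraints `(P + Q) i i = 1`, when `(P, Q)` maximises
`pairing X` on `feasiblePairs`. -/
def multiplier (X : Matrix ι ι ℂ) (p : Matrix ι ι ℂ × Matrix ι ι ℂ) (i : ι) : ℝ :=
  (((p.1 - p.2) * X) i i).re

theorem sum_multiplier (X : Matrix ι ι ℂ) (p : Matrix ι ι ℂ × Matrix ι ι ℂ) :
    ∑ i, multiplier X p i = pairing X p := by
  simp [multiplier, pairing, trace]

theorem multiplier_neg_swap (X : Matrix ι ι ℂ) (p : Matrix ι ι ℂ × Matrix ι ι ℂ) :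
    multiplier (-X) p.swap = multiplier X p := by
  ext
  simp [multiplier, sub_mul]

theorem pairing_neg_swap (X : Matrix ι ι ℂ) (p : Matrix ι ι ℂ × Matrix ι ι ℂ) :
    pairing (-X) p.swap = pairing X p := by
  simp only [← sum_multiplier, multiplier_neg_swap]

theorem exists_isMaxOn_pairing (X : Matrix ι ι ℂ) :
    ∃ p ∈ feasiblePairs ι, IsMaxOn (pairing X) (feasiblePairs ι) p := by
  classical
  refine isCompact_feasiblePairs.exists_isMaxOn ⟨(1, 0), PosSemidef.one.nonneg, le_rfl, by simp⟩ ?_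
  have : Continuous (pairing X) := by unfold pairing; fun_prop
  exact this.continuousOn

variable {X S : Matrix ι ι ℂ}

/-- The pair `(C P C + S, C Q C)` with `C = diagonal c`. For positive `S` it is feasible as soon as
`C ^ 2` compensates the diagonal of `S`. -/
def perturb [DecidableEq ι] (S : Matrix ι ι ℂ) (c : ι → ℝ) (p : Matrix ι ι ℂ × Matrix ι ι ℂ) :
    Matrix ι ι ℂ × Matrix ι ι ℂ :=
  (diagonal (fun i => (c i : ℂ)) * p.1 * diagonal (fun i => (c i : ℂ)) + S,
    diagonal (fun i => (c i : ℂ)) * p.2 * diagonal (fun i => (c i : ℂ)))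

theorem perturb_mem_feasiblePairs [DecidableEq ι] (hp : p ∈ feasiblePairs ι) (hS : S.PosSemidef)
    {c : ι → ℝ} (hc : ∀ i, c i ^ 2 + (S i i).re = 1) : perturb S c p ∈ feasiblePairs ι := by
  obtain ⟨hP, hQ, hdiag⟩ := hp
  have hC : IsSelfAdjoint (diagonal fun i => (c i : ℂ)) :=
    isHermitian_diagonal_of_self_adjoint _ (by ext; simp)
  refine ⟨add_nonneg (hC.conjugate_nonneg hP) hS.nonneg, hC.conjugate_nonneg hQ, ?_⟩
  ext i
  have hPQ : p.1 i i + p.2 i i = 1 := congrFun hdiag i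
  have hSi : ((S i i).re : ℂ) = S i i := hS.isHermitian.coe_re_apply_self i
  have hci : (c i : ℂ) ^ 2 + S i i = 1 := by
    rw [← hSi]
    exact_mod_cast hc i
  simp only [perturb, diag_apply, Matrix.add_apply, mul_diagonal, diagonal_mul, Pi.one_apply]
  linear_combination (c i : ℂ) ^ 2 * hPQ + hci

theorem pairing_perturb [DecidableEq ι] (X S : Matrix ι ι ℂ) (c : ι → ℝ)
    (p : Matrix ι ι ℂ × Matrix ι ι ℂ) :
    pairing X (perturb S c p) =
      (∑ i, ∑ j, c i * c j * ((p.1 - p.2) i j * X j i).re) + (S * X).trace.re := by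
  have hsub : (perturb S c p).1 - (perturb S c p).2 =
      diagonal (fun i => (c i : ℂ)) * (p.1 - p.2) * diagonal (fun i => (c i : ℂ)) + S := by
    simp only [perturb, mul_sub, sub_mul]
    abel
  rw [pairing, hsub, add_mul, trace_add, Complex.add_re, trace, Complex.re_sum]
  congr 1
  refine Finset.sum_congr rfl fun i _ => ?_
  rw [diag_apply, mul_apply, Complex.re_sum]
  refine Finset.sum_congr rfl fun j _ => ?_
  rw [mul_diagonal, diagonal_mul, ← Complex.re_ofReal_mul]
  push_cast
  ring_nf

theorem re_trace_mul_le_sum_multiplier (hX : X.IsHermitian) (hp : p ∈ feasiblePairs ι)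
    (hmax : IsMaxOn (pairing X) (feasiblePairs ι) p) (hS : S.PosSemidef) :
    (S * X).trace.re ≤ ∑ i, (S i i).re * multiplier X p i := by
  classical
  set c : ℝ → ι → ℝ := fun t i => √(1 - t * (S i i).re)
  set f : ℝ → ℝ := fun t => pairing X (perturb (t • S) (c t) p)
  have hderiv : HasDerivAt f (-(∑ i, (S i i).re * multiplier X p i) + (S * X).trace.re) 0 := by
    have hW : (p.1 - p.2).IsHermitian :=
      hp.1.posSemidef.isHermitian.sub hp.2.1.posSemidef.isHermitian
    have hsum := (hasDerivAt_sum_sqrt_mul_sqrt (re_mul_apply_comm hW hX) fun i => (S i i).re).add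
      ((hasDerivAt_id (0 : ℝ)).mul_const (S * X).trace.re)
    refine (hsum.congr_deriv ?_).congr_of_eventuallyEq (.of_forall fun t => ?_)
    · simp [multiplier, mul_apply]
    · simp [f, c, pairing_perturb]
  have hzero : f 0 = pairing X p := by
    simp [f, c, perturb]
  have hle : IsLocalMaxOn f (Set.Ici 0) 0 := by
    have hsmall : ∀ᶠ t : ℝ in nhds 0, ∀ i, 0 < 1 - t * (S i i).re :=
      Filter.eventually_all.2 fun i =>
        ContinuousAt.eventually_lt (by fun_prop) (by fun_prop) (by simp)
    filter_upwards [self_mem_nhdsWithin, mem_nhdsWithin_of_mem_nhds hsmall] with t ht hpos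
    rw [hzero]
    refine hmax (perturb_mem_feasiblePairs hp (hS.smul ht) fun i => ?_)
    simp [c, Real.sq_sqrt (hpos i).le]
  linarith [hasDerivAt_nonpos_of_isLocalMaxOn_Ici hle hderiv]

end Pairing

section Optimality

variable {n : ℕ} {X : Matrix (Fin n) (Fin n) ℂ} {lam : Fin n → ℝ}
  {p : Matrix (Fin n) (Fin n) ℂ × Matrix (Fin n) (Fin n) ℂ}

theorem le_Delta_multiplier (hX : X.IsHermitian) (hp : p ∈ feasiblePairs (Fin n))
    (hmax : IsMaxOn (pairing X) (feasiblePairs (Fin n)) p) : X ≤ Delta (multiplier X p) := by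
  refine posSemidef_of_forall_trace_mul_nonneg ((isHermitian_Delta _).sub hX) fun S hS => ?_
  have htrace : (S * Delta (multiplier X p)).trace.re = ∑ i, (S i i).re * multiplier X p i := by
    simp [Delta, trace]
  rw [mul_sub, trace_sub, Complex.sub_re, htrace, sub_nonneg]
  exact re_trace_mul_le_sum_multiplier hX hp hmax hS

theorem neg_Delta_multiplier_le (hX : X.IsHermitian) (hp : p ∈ feasiblePairs (Fin n))
    (hmax : IsMaxOn (pairing X) (feasiblePairs (Fin n)) p) : -Delta (multiplier X p) ≤ X := by
  have hswap : IsMaxOn (pairing (-X)) (feasiblePairs (Fin n)) p.swap := fun q hq => by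
    have := hmax (swap_mem_feasiblePairs hq)
    rw [Set.mem_ofPred_eq] at this ⊢
    rwa [pairing_neg_swap, ← Prod.swap_swap q, pairing_neg_swap]
  have := le_Delta_multiplier hX.neg (swap_mem_feasiblePairs hp) hswap
  rwa [multiplier_neg_swap, neg_le] at this

theorem trace_mul_add_trace_mul_eq (hdiag : (p.1 + p.2).diag = 1) :
    (p.1 * (Delta lam - X)).trace + (p.2 * (X - -Delta lam)).trace =
      (∑ i, lam i : ℝ) - ((p.1 - p.2) * X).trace := by
  have htrace : ((p.1 + p.2) * Delta lam).trace = (∑ i, lam i : ℝ) := by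
    have hi (i : Fin n) : p.1 i i + p.2 i i = 1 := congrFun hdiag i
    simp [Delta, trace, hi]
  rw [← htrace, ← trace_add, ← trace_sub]
  congr 1
  noncomm_ring

theorem mul_eq_zero_of_sum_eq_pairing (hp : p ∈ feasiblePairs (Fin n)) (hneg : -Delta lam ≤ X)
    (hpos : X ≤ Delta lam) (hsum : ∑ i, lam i = pairing X p) :
    p.1 * (Delta lam - X) = 0 ∧ p.2 * (X - -Delta lam) = 0 := by
  have hP := hp.1.posSemidef
  have hQ := hp.2.1.posSemidef
  have hleft := trace_mul_nonneg hP hpos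
  have hright := trace_mul_nonneg hQ hneg
  have hre := congrArg Complex.re (trace_mul_add_trace_mul_eq (lam := lam) (X := X) hp.2.2)
  rw [Complex.sub_re, Complex.ofReal_re, hsum, pairing, sub_self] at hre
  have hadd : (p.1 * (Delta lam - X)).trace + (p.2 * (X - -Delta lam)).trace = 0 :=
    Complex.ext hre (Complex.nonneg_iff.1 (add_nonneg hleft hright)).2.symm
  obtain ⟨hl, hr⟩ := (add_eq_zero_iff_of_nonneg hleft hright).1 hadd
  exact ⟨mul_eq_zero_of_trace_mul_eq_zero hP hpos hl, mul_eq_zero_of_trace_mul_eq_zero hQ hneg hr⟩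

theorem eq_multiplier_of_sum_eq_pairing (hp : p ∈ feasiblePairs (Fin n)) (hneg : -Delta lam ≤ X)
    (hpos : X ≤ Delta lam) (hsum : ∑ i, lam i = pairing X p) : lam = multiplier X p := by
  obtain ⟨hP, hQ⟩ := mul_eq_zero_of_sum_eq_pairing hp hneg hpos hsum
  have hprod : (p.1 + p.2) * Delta lam = (p.1 - p.2) * X := by
    rw [← sub_eq_zero, ← add_zero (0 : Matrix (Fin n) (Fin n) ℂ)]
    nth_rw 1 [← hP]
    rw [← hQ]
    noncomm_ring
  ext i
  have hi : p.1 i i + p.2 i i = 1 := congrFun hp.2.2 i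
  rw [multiplier, ← hprod, Delta, mul_diagonal, Matrix.add_apply, hi, one_mul, Complex.ofReal_re]

theorem cbBNorm_eq_pairing (hX : X.IsHermitian) (hp : p ∈ feasiblePairs (Fin n))
    (hmax : IsMaxOn (pairing X) (feasiblePairs (Fin n)) p) : cbBNorm X = pairing X p := by
  have hneg := neg_Delta_multiplier_le hX hp hmax
  have hpos := le_Delta_multiplier hX hp hmax
  have hP := hp.1.posSemidef
  have hQ := hp.2.1.posSemidef
  rw [← sum_multiplier]
  refine (isFactor_pinvSqrtDelta_conj hX hneg hpos).cbBNorm_eq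
    (nonneg_of_neg_Delta_le_of_le_Delta hneg hpos) (schurNorm_sub_le_one hP hQ hp.2.2) ?_
  rw [(hP.isHermitian.sub hQ.isHermitian).eq, sum_multiplier]
  exact Complex.re_le_norm _

end Optimality

end SchurDual

theorem theorem1p8 {n : ℕ} (X : Matrix (Fin n) (Fin n) ℂ) (hX : X.IsHermitian) :
    (∀ lam : Fin n → ℝ, (∀ i, 0 ≤ lam i) →
      -SchurDual.Delta lam ≤ X → X ≤ SchurDual.Delta lam →
        SchurDual.cbBNorm X ≤ (SchurDual.Delta lam).trace.re) ∧
    (∃! lam : Fin n → ℝ, (∀ i, 0 ≤ lam i) ∧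
      (SchurDual.Delta lam).trace = (SchurDual.cbBNorm X : ℂ) ∧
      ∃ B : Matrix (Fin n) (Fin n) ℂ, SchurDual.IsFactor X lam B) ∧
    (∀ lam : Fin n → ℝ, (∀ i, 0 ≤ lam i) →
      (SchurDual.Delta lam).trace = (SchurDual.cbBNorm X : ℂ) →
      (∃ B : Matrix (Fin n) (Fin n) ℂ, SchurDual.IsFactor X lam B) →
      ∃! B : Matrix (Fin n) (Fin n) ℂ, SchurDual.IsFactor X lam B ∧
        SchurDual.support B ≤ SchurDual.support (SchurDual.Delta lam)) := by
  open SchurDual in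
  simp only [trace_Delta, Complex.ofReal_re, Complex.ofReal_inj]
  refine ⟨fun lam hlam hneg hpos => ?_, ?_, fun lam hlam _ ⟨B, hB⟩ => ?_⟩
  · exact (isFactor_pinvSqrtDelta_conj hX hneg hpos).cbBNorm_le hlam
  · obtain ⟨p, hp, hmax⟩ := exists_isMaxOn_pairing X
    have hneg := neg_Delta_multiplier_le hX hp hmax
    have hpos := le_Delta_multiplier hX hp hmax
    rw [cbBNorm_eq_pairing hX hp hmax]
    refine ⟨multiplier X p, ⟨nonneg_of_neg_Delta_le_of_le_Delta hneg hpos, sum_multiplier X p,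
      _, isFactor_pinvSqrtDelta_conj hX hneg hpos⟩, ?_⟩
    rintro lam ⟨hlam, hsum, B, hB⟩
    obtain ⟨hneg', hpos'⟩ := hB.neg_Delta_le_and_le_Delta hlam
    exact eq_multiplier_of_sum_eq_pairing hp hneg' hpos' hsum
  · obtain ⟨hneg, hpos⟩ := hB.neg_Delta_le_and_le_Delta hlam
    exact existsUnique_isFactor_support_le hX hneg hpos
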